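/- For $z_1,z_2,z_3\in\mathbb C$ let $K(z_1,z_2,z_3)$ denote their convex hull in $\mathbb C\cong\mathbb R^2$ (a triangle set, possibly degenerate). For $S,T\subseteq\mathbb C$ put $ST=\{st: s\in S,\ t\in T\}$. A point $p\in S$ is a star center of $S$ if $S$ contains the line segment joining $p$ to $s$ for every $s\in S$, and $S$ is star-shaped if it has a star center. For $A\in M_n(\mathbb C)$ let $W(A)=\{x^*Ax: x\in\mathbb C^n,\ x^*x=1\}$ be its numerical range. (1) Let $K_1$ be a triangle set that is symmetric about the real axis, i.e. $\{\bar z: z\in K_1\}=K_1$. Then there are $r\in\mathbb R$ and $a\in\mathbb C$ with $K_1=K(r,a,\bar a)$; and for all $r\in\mathbb R$ and $a\in\mathbb C$ with $K_1=K(r,a,\bar a)$, the product set $K_1K_1$ is star-shaped with $|a|^2$ as a star center. (2) Let $A$ be a real normal $3\times 3$ matrix. Then $W(A)W(A)$ is star-shaped. If moreover $A$ is Hermitian (that is, symmetric), then $W(A)W(A)$ is convex. If $A$ is not Hermitian, then its set of complex eigenvalues is $\{r,a,\bar a\}$ for some $r\in\mathbb R$ and $a\in\mathbb C\setminus\mathbb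 R$, and $|a|^2$ is a star center of $W(A)W(A)$. -/

import Mathlib

open scoped Pointwise

/-- The closed triangle (with interior) with vertices `z₁, z₂, z₃`: their convex hull in the
real plane `ℂ`. The vertices are allowed to be collinear. -/
def triangleHull (z₁ z₂ z₃ : ℂ) : Set ℂ := convexHull ℝ {z₁, z₂, z₃}

/-- A triangle set: the convex hull of three complex numbers. -/
def IsTriangleSet (K : Set ℂ) : Prop := ∃ z₁ z₂ z₃ : ℂ, K = triangleHull z₁ z₂ z₃

/-- `p` is a star center of `S`: it belongs to `S`, and `S` contains the segment from `p` to
each of its points. -/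
def IsStarCenter (p : ℂ) (S : Set ℂ) : Prop := p ∈ S ∧ StarConvex ℝ p S

/-- A set is star-shaped if it has a star center. -/
def IsStarShaped (S : Set ℂ) : Prop := ∃ p : ℂ, IsStarCenter p S

/-- The numerical range `W(A) = {x* A x : x* x = 1}` of a complex square matrix. -/
def numRange {n : ℕ} (A : Matrix (Fin n) (Fin n) ℂ) : Set ℂ :=
  {z | ∃ x : Fin n → ℂ, star x ⬝ᵥ x = 1 ∧ z = star x ⬝ᵥ A.mulVec x}

/-- A real matrix regarded as a complex one. -/
def toComplexMatrix {n : ℕ} (A : Matrix (Fin n) (Fin n) ℝ) : Matrix (Fin n) (Fin n) ℂ :=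
  A.map (fun t : ℝ => (t : ℂ))

/-! Let K = K(r, a, b) with b the conjugate of a, and suppose p lies on the segment from ab = |a|²
to z₁w₁ but not in KK. Then zw - p has no zero on K × K and carries a continuous angle θ there,
normalized by θ(a, b) = 0. With one variable fixed, zw runs through a convex set avoiding p, so θ
varies by less than π on each slice. The same holds on the twisted diagonal w = conj z, where zw =
|z|² fills a real interval. The diagonal joins (a, b) to (b, a), where the product is the same, and
to (r, r); hence θ(b, a) = 0 and |θ(r, r)| < π. Slices through (a, b) and (b, a) give |θ| < π
whenever either coordinate is a or b. The angle of an affine function is quasiconvex and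
quasiconcave (`convex_setOf_abs_angle_lt`), so the bound |θ| < π spreads from the vertices to all of
K, one variable at a time. But p between ab and z₁w₁ forces θ(z₁, w₁) to be an odd multiple of π, a
contradiction. For matrices, a unitary diagonalization makes W(A) the hull of the eigenvalues. In
the symmetric case W(A) is real and W(A)W(A) is an interval; otherwise the eigenvalues are r, a,
conj a and the triangle result applies. -/

/-! ### Continuous angles along convex sets -/

-- If the quotient were -l with l ≥ 0, then p = (l u + v) / (1 + l) would be a convex combination of
-- u and v.
open Complex Set in
lemma div_mem_slitPlane_of_not_mem_segment {p u v : ℂ} (h : p ∉ segment ℝ u v) :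
    (v - p) / (u - p) ∈ slitPlane := by
  by_contra hs
  have hu : u - p ≠ 0 := fun h0 => h (by
    rw [← sub_eq_zero.1 h0]; exact left_mem_segment ℝ _ _)
  rw [mem_slitPlane_iff, not_or, not_lt, not_not] at hs
  obtain ⟨hre, him⟩ := hs
  set l : ℝ := -((v - p) / (u - p)).re with hl
  have hl0 : 0 ≤ l := by linarith
  have h1 : (v - p) / (u - p) = ((-l : ℝ) : ℂ) := by
    apply Complex.ext <;> simp [hl, him]
  rw [div_eq_iff hu] at h1
  have hl1 : (1 + l : ℂ) ≠ 0 := by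
    have : (1 + l : ℝ) ≠ 0 := by positivity
    exact_mod_cast this
  refine h ⟨l / (1 + l), 1 / (1 + l), by positivity, by positivity, by field_simp; ring, ?_⟩
  simp only [real_smul]
  push_cast at h1 ⊢
  field_simp
  linear_combination h1

/-- A continuous determination `θ` of the angle of `f - p` (up to a constant factor `c`) changes
by a principal argument, as long as `f` stays in a convex set that avoids `p`. -/
lemma angle_sub_eq_arg {α : Type*} [TopologicalSpace α] {X : Set α} (hX : IsPreconnected X)
    {f : α → ℂ} (hf : ContinuousOn f X) {C : Set ℂ} (hC : Convex ℝ C) (hfC : Set.MapsTo f X C)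
    {p : ℂ} (hp : p ∉ C) {θ : α → ℝ} (hθ : ContinuousOn θ X) {c : ℂ} (hc : c ≠ 0)
    (h : ∀ x ∈ X, (f x - p) * c = ‖(f x - p) * c‖ * Complex.exp (θ x * Complex.I))
    {x y : α} (hx : x ∈ X) (hy : y ∈ X) :
    θ y - θ x = Complex.arg ((f y - p) / (f x - p)) := by
  have hslit : ∀ y ∈ X, (f y - p) / (f x - p) ∈ Complex.slitPlane := fun y hy =>
    div_mem_slitPlane_of_not_mem_segment fun hs =>
      hp (hC.segment_subset (hfC hx) (hfC hy) hs)
  have hne : ∀ y ∈ X, f y - p ≠ 0 := fun y hy h0 => hp (by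
    rw [← sub_eq_zero.1 h0]; exact hfC hy)
  -- The discrepancy g is continuous, vanishes at x and takes values in 2πℤ, so connectedness forces
  -- it to be zero.
  set g : α → ℝ := fun y => θ y - θ x - Complex.arg ((f y - p) / (f x - p)) with hg
  have hgc : ContinuousOn g X := by
    refine (hθ.sub continuousOn_const).sub fun y hy => ?_
    have h1 : ContinuousWithinAt (fun y => (f y - p) / (f x - p)) X y :=
      ((hf y hy).sub continuousWithinAt_const).div_const _
    exact ContinuousAt.comp_continuousWithinAt (f := fun y => (f y - p) / (f x - p))
      (Complex.continuousAt_arg (hslit y hy)) h1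
  have hgx : g x = 0 := by
    simp [hg, div_self (hne x hx)]
  have hgn : ∀ y ∈ X, ∃ n : ℤ, g y = n * (2 * Real.pi) := by
    intro y hy
    have e1 := h x hx
    have e2 := h y hy
    have nx : (‖(f x - p) * c‖ : ℂ) ≠ 0 := by
      simpa using ⟨hne x hx, hc⟩
    have ny : (‖(f y - p) * c‖ : ℂ) ≠ 0 := by
      simpa using ⟨hne y hy, hc⟩
    have e3 := Complex.norm_mul_exp_arg_mul_I ((f y - p) / (f x - p))
    have e4 : (f y - p) / (f x - p) = ((f y - p) * c) / ((f x - p) * c) := by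
      rw [mul_div_mul_right _ _ hc]
    have e5 : ‖(f y - p) / (f x - p)‖ = ‖(f y - p) * c‖ / ‖(f x - p) * c‖ := by
      rw [e4, norm_div]
    have key : Complex.exp ((g y : ℂ) * Complex.I) = 1 := by
      have e6 : Complex.exp ((g y : ℂ) * Complex.I) = Complex.exp (θ y * Complex.I) /
          Complex.exp (θ x * Complex.I) /
            Complex.exp (Complex.arg ((f y - p) / (f x - p)) * Complex.I) := by
        rw [← Complex.exp_sub, ← Complex.exp_sub]
        congr 1
        simp only [hg]
        push_cast
        ring
      rw [e6]
      have n1 := Complex.exp_ne_zero (θ x * Complex.I)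
      have n2 := Complex.exp_ne_zero (Complex.arg ((f y - p) / (f x - p)) * Complex.I)
      rw [div_div, div_eq_one_iff_eq (mul_ne_zero n1 n2)]
      apply mul_left_cancel₀ ny
      rw [← e2]
      have e7 : (‖(f y - p) * c‖ : ℂ) =
          ‖(f y - p) / (f x - p)‖ * ‖(f x - p) * c‖ := by
        rw [e5, Complex.ofReal_div, div_mul_cancel₀ _ nx]
      rw [e7]
      calc (f y - p) * c = ((f y - p) / (f x - p)) * ((f x - p) * c) := by
            have := hne x hx
            field_simp
        _ = (‖(f y - p) / (f x - p)‖ *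
              Complex.exp (Complex.arg ((f y - p) / (f x - p)) * Complex.I)) *
              (‖(f x - p) * c‖ * Complex.exp (θ x * Complex.I)) := by rw [e3, ← e1]
        _ = _ := by ring
    obtain ⟨n, hn⟩ := Complex.exp_eq_one_iff.1 key
    refine ⟨n, ?_⟩
    have : (g y : ℂ) = ((n * (2 * Real.pi) : ℝ) : ℂ) := by
      apply mul_right_cancel₀ Complex.I_ne_zero
      rw [hn]; push_cast; ring
    exact_mod_cast this
  have hord := (hX.image g hgc).ordConnected
  obtain ⟨n, hn⟩ := hgn y hy
  have hpi := Real.pi_pos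
  -- The image of g is order-connected but misses ±π, so it cannot contain both 0 and a nonzero
  -- multiple of 2π.
  have notmem : ∀ (m : ℤ) , (2 * m + 1 : ℝ) * Real.pi ∉ g '' X := by
    rintro m ⟨z, hz, hz'⟩
    obtain ⟨k, hk⟩ := hgn z hz
    rw [hk] at hz'
    have : (k * 2 : ℝ) = 2 * m + 1 := by
      apply mul_right_cancel₀ hpi.ne'
      linarith
    have : k * 2 = 2 * m + 1 := by exact_mod_cast this
    omega
  have hn0 : n = 0 := by
    rcases lt_trichotomy n 0 with h0 | h0 | h0
    · exfalso
      have h1 : (n : ℝ) ≤ -1 := by exact_mod_cast (by omega : n ≤ -1)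
      refine notmem (-1) (hord.out ⟨y, hy, rfl⟩ ⟨x, hx, rfl⟩ ⟨?_, ?_⟩)
      · rw [hn]; push_cast; nlinarith
      · rw [hgx]; push_cast; nlinarith
    · exact h0
    · exfalso
      have h1 : (1 : ℝ) ≤ n := by exact_mod_cast (by omega : 1 ≤ n)
      refine notmem 0 (hord.out ⟨x, hx, rfl⟩ ⟨y, hy, rfl⟩ ⟨?_, ?_⟩)
      · rw [hgx]; push_cast; nlinarith
      · rw [hn]; push_cast; nlinarith
  have : g y = 0 := by rw [hn, hn0]; simp
  simp only [hg] at this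
  linarith

lemma abs_angle_sub_lt_pi {α : Type*} [TopologicalSpace α] {X : Set α} (hX : IsPreconnected X)
    {f : α → ℂ} (hf : ContinuousOn f X) {C : Set ℂ} (hC : Convex ℝ C) (hfC : Set.MapsTo f X C)
    {p : ℂ} (hp : p ∉ C) {θ : α → ℝ} (hθ : ContinuousOn θ X) {c : ℂ} (hc : c ≠ 0)
    (h : ∀ x ∈ X, (f x - p) * c = ‖(f x - p) * c‖ * Complex.exp (θ x * Complex.I))
    {x y : α} (hx : x ∈ X) (hy : y ∈ X) :
    |θ y - θ x| < Real.pi := by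
  rw [angle_sub_eq_arg hX hf hC hfC hp hθ hc h hx hy]
  have hs := div_mem_slitPlane_of_not_mem_segment (p := p) (u := f x) (v := f y) fun hs =>
      hp (hC.segment_subset (hfC hx) (hfC hy) hs)
  exact abs_lt.2 ⟨Complex.neg_pi_lt_arg _,
    (Complex.arg_le_pi _).lt_of_ne (Complex.mem_slitPlane_iff_arg.1 hs).1⟩

/-- A continuous angle of an affine function is quasiconvex and quasiconcave. -/
lemma convex_setOf_abs_angle_lt {K : Set ℂ} (hK : Convex ℝ K) {w p : ℂ}
    (hp : ∀ z ∈ K, z * w ≠ p) {θ : ℂ → ℝ} (hθ : ContinuousOn θ K) {c : ℂ} (hc : c ≠ 0)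
    (h : ∀ z ∈ K, (z * w - p) * c = ‖(z * w - p) * c‖ * Complex.exp (θ z * Complex.I)) (M : ℝ) :
    Convex ℝ {z ∈ K | |θ z| < M} := by
  have hC : Convex ℝ ((fun z => z * w) '' K) :=
    hK.is_linear_image (IsLinearMap.mk (fun x y => by ring) (fun c x => by simp [mul_assoc]))
  have hfC : Set.MapsTo (fun z => z * w) K ((fun z => z * w) '' K) := Set.mapsTo_image _ _
  have hpC : p ∉ (fun z => z * w) '' K := by
    rintro ⟨z, hz, hz'⟩; exact hp z hz hz'
  have hd : ∀ {x y : ℂ}, x ∈ K → y ∈ K →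
      θ y - θ x = Complex.arg ((y * w - p) / (x * w - p)) := fun hx hy =>
    angle_sub_eq_arg hK.isPreconnected (f := fun z => z * w) (by fun_prop) hC hfC hpC hθ hc h hx hy
  have hne : ∀ z ∈ K, z * w - p ≠ 0 := fun z hz => sub_ne_zero.2 (hp z hz)
  have inv_im : ∀ u v : ℂ, 0 ≤ (u / v).im ↔ (v / u).im ≤ 0 := by
    intro u v
    rw [← inv_div, Complex.inv_im]
    rcases eq_or_ne (v / u) 0 with h0 | h0
    · simp [h0]
    · have : 0 < Complex.normSq (v / u) := Complex.normSq_pos.2 h0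
      rw [div_nonneg_iff]
      constructor
      · rintro (h | h)
        · linarith [h.1]
        · linarith [h.2]
      · intro h; left; constructor <;> linarith
  -- the angle at a point of the segment lies between the angles at the ends
  have between : ∀ {x y : ℂ}, x ∈ K → y ∈ K → ∀ {s t : ℝ}, 0 ≤ s → 0 ≤ t → s + t = 1 →
      (θ x ≤ θ (s • x + t • y) ∧ θ (s • x + t • y) ≤ θ y) ∨
      (θ y ≤ θ (s • x + t • y) ∧ θ (s • x + t • y) ≤ θ x) := by
    intro x y hx hy s t hs ht hst
    have hm := hK hx hy hs ht hst
    set m := s • x + t • y with hmdef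
    have hst' : (s : ℂ) + t = 1 := by exact_mod_cast hst
    have hmw : m * w - p = s * (x * w - p) + t * (y * w - p) := by
      simp only [hmdef, Complex.real_smul]
      linear_combination p * hst'
    -- Seen from either end, the intermediate point has the imaginary part of the far end scaled by
    -- a nonnegative real, so both partial turns have the same sense as the whole turn.
    have e1 : ((m * w - p) / (x * w - p)).im = t * ((y * w - p) / (x * w - p)).im := by
      rw [hmw, add_div, mul_div_assoc, mul_div_assoc, div_self (hne x hx)]
      simp
    have e2 : ((m * w - p) / (y * w - p)).im = s * ((x * w - p) / (y * w - p)).im := by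
      rw [hmw, add_div, mul_div_assoc, mul_div_assoc, div_self (hne y hy)]
      simp
    rcases le_total 0 ((y * w - p) / (x * w - p)).im with h0 | h0
    · left
      have h1 := (inv_im _ _).1 h0
      constructor
      · rw [← sub_nonneg, hd hx hm, Complex.arg_nonneg_iff, e1]
        positivity
      · rw [← sub_nonneg, hd hm hy, Complex.arg_nonneg_iff, inv_im, e2]
        exact mul_nonpos_of_nonneg_of_nonpos hs h1
    · right
      have h1 := (inv_im _ _).2 h0
      constructor
      · rw [← sub_nonneg, hd hy hm, Complex.arg_nonneg_iff, e2]
        positivity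
      · rw [← sub_nonneg, hd hm hx, Complex.arg_nonneg_iff, inv_im, e1]
        exact mul_nonpos_of_nonneg_of_nonpos ht h0
  rintro x ⟨hx, hxM⟩ y ⟨hy, hyM⟩ s t hs ht hst
  refine ⟨hK hx hy hs ht hst, ?_⟩
  rw [abs_lt] at hxM hyM ⊢
  rcases between hx hy hs ht hst with h | h <;> constructor <;> linarith [h.1, h.2]

/-! ### The star center of the product of a symmetric triangle with itself -/

lemma triangleHull_subset {z₁ z₂ z₃ : ℂ} {C : Set ℂ} (hC : Convex ℝ C) (h₁ : z₁ ∈ C)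
    (h₂ : z₂ ∈ C) (h₃ : z₃ ∈ C) : triangleHull z₁ z₂ z₃ ⊆ C :=
  convexHull_min (by simp [Set.insert_subset_iff, h₁, h₂, h₃]) hC

lemma conj_mem_of_triangleHull {r : ℝ} {a z : ℂ}
    (hz : z ∈ triangleHull (r : ℂ) a (starRingEnd ℂ a)) :
    starRingEnd ℂ z ∈ triangleHull (r : ℂ) a (starRingEnd ℂ a) := by
  have hC : Convex ℝ ((starRingEnd ℂ) ⁻¹' triangleHull (r : ℂ) a (starRingEnd ℂ a)) :=
    (convex_convexHull ℝ _).is_linear_preimage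
      (IsLinearMap.mk (fun x y => by simp) (fun c x => by simp))
  refine triangleHull_subset hC ?_ ?_ ?_ hz <;> apply subset_convexHull <;> simp

lemma continuousAt_arg_comp {α : Type*} [TopologicalSpace α] {g : α → ℂ} {x : α}
    (hg : ContinuousAt g x) (hx : g x ∈ Complex.slitPlane) :
    ContinuousAt (fun y => Complex.arg (g y)) x :=
  ContinuousAt.comp (f := g) (Complex.continuousAt_arg hx) hg

/-- If `p` is not a product of two elements of the convex set `K`, then `z * w - p` has a
continuous angle on `K ×ˢ K`. -/
lemma exists_continuousOn_angle_mul {K : Set ℂ} (hK : Convex ℝ K) {a b p : ℂ} (haK : a ∈ K)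
    (hbK : b ∈ K) (hp' : ∀ z ∈ K, ∀ w ∈ K, z * w ≠ p) :
    ∃ θ : ℂ × ℂ → ℝ, ContinuousOn θ (K ×ˢ K) ∧ θ (a, b) = 0 ∧
      ∀ z ∈ K, ∀ w ∈ K, (z * w - p) * (a * b - p)⁻¹ =
        ‖(z * w - p) * (a * b - p)⁻¹‖ * Complex.exp (θ (z, w) * Complex.I) := by
  have hmulL : ∀ w : ℂ, Convex ℝ ((fun z => z * w) '' K) := fun w =>
    hK.is_linear_image (IsLinearMap.mk (fun x y => by ring) (fun c x => by simp [mul_assoc]))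
  have hseg : ∀ z ∈ K, ∀ z' ∈ K, ∀ w ∈ K, p ∉ segment ℝ (z * w) (z' * w) := by
    intro z hz z' hz' w hw h
    obtain ⟨u, hu, hu'⟩ := (hmulL w).segment_subset ⟨z, hz, rfl⟩ ⟨z', hz', rfl⟩ h
    exact hp' u hu w hw hu'
  -- The angle is accumulated along (a, b) → (a, w) → (z, w). Each leg stays in one slice, so both
  -- quotients lie in the slit plane and the principal arguments are continuous.
  set θ : ℂ × ℂ → ℝ := fun x => Complex.arg ((a * x.2 - p) / (a * b - p)) +
    Complex.arg ((x.1 * x.2 - p) / (a * x.2 - p)) with hθdef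
  have hs1 : ∀ w ∈ K, (a * w - p) / (a * b - p) ∈ Complex.slitPlane := fun w hw =>
    div_mem_slitPlane_of_not_mem_segment (by
      rw [mul_comm a b, mul_comm a w]; exact hseg b hbK w hw a haK)
  have hs2 : ∀ z ∈ K, ∀ w ∈ K, (z * w - p) / (a * w - p) ∈ Complex.slitPlane :=
    fun z hz w hw => div_mem_slitPlane_of_not_mem_segment (hseg a haK z hz w hw)
  have hθ : ContinuousOn θ (K ×ˢ K) := by
    rintro ⟨z, w⟩ ⟨hz, hw⟩
    have n1 : a * w - p ≠ 0 := sub_ne_zero.2 (hp' a haK w hw)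
    have c1 : ContinuousAt (fun x : ℂ × ℂ => (a * x.2 - p) / (a * b - p)) (z, w) := by fun_prop
    have c2 : ContinuousAt (fun x : ℂ × ℂ => (x.1 * x.2 - p) / (a * x.2 - p)) (z, w) := by
      fun_prop (disch := exact n1)
    exact ((continuousAt_arg_comp c1 (hs1 w hw)).add
      (continuousAt_arg_comp c2 (hs2 z hz w hw))).continuousWithinAt
  have hang : ∀ z ∈ K, ∀ w ∈ K, (z * w - p) * (a * b - p)⁻¹ =
      ‖(z * w - p) * (a * b - p)⁻¹‖ * Complex.exp (θ (z, w) * Complex.I) := by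
    intro z hz w hw
    have n1 : a * w - p ≠ 0 := sub_ne_zero.2 (hp' a haK w hw)
    have e0 : (z * w - p) * (a * b - p)⁻¹ =
        ((a * w - p) / (a * b - p)) * ((z * w - p) / (a * w - p)) := by
      rw [← div_eq_mul_inv, mul_comm (_ / _), div_mul_div_cancel₀ n1]
    rw [e0, norm_mul]
    simp only [hθdef]
    push_cast
    rw [add_mul, Complex.exp_add]
    conv_lhs => rw [← Complex.norm_mul_exp_arg_mul_I ((a * w - p) / (a * b - p)),
      ← Complex.norm_mul_exp_arg_mul_I ((z * w - p) / (a * w - p))]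
    ring
  have hn0 : a * b - p ≠ 0 := sub_ne_zero.2 (hp' a haK b hbK)
  exact ⟨θ, hθ, by simp [hθdef, div_self hn0], hang⟩

theorem isStarCenter_mul_self_triangleHull (r : ℝ) (a : ℂ) :
    IsStarCenter ((‖a‖ ^ 2 : ℝ) : ℂ)
      (triangleHull (r : ℂ) a (starRingEnd ℂ a) * triangleHull (r : ℂ) a (starRingEnd ℂ a)) := by
  set b := starRingEnd ℂ a with hb
  set K := triangleHull (r : ℂ) a b with hKdef
  have hK : Convex ℝ K := convex_convexHull ℝ _
  have hrK : (r : ℂ) ∈ K := subset_convexHull _ _ (by simp)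
  have haK : a ∈ K := subset_convexHull _ _ (by simp)
  have hbK : b ∈ K := subset_convexHull _ _ (by simp)
  have hconj : ∀ z ∈ K, starRingEnd ℂ z ∈ K := fun z hz => conj_mem_of_triangleHull hz
  have hab : ((‖a‖ ^ 2 : ℝ) : ℂ) = a * b := by
    rw [hb, Complex.mul_conj, Complex.normSq_eq_norm_sq]
  rw [hab]
  refine ⟨Set.mul_mem_mul haK hbK, starConvex_iff_segment_subset.2 ?_⟩
  rintro _ ⟨z₁, hz₁, w₁, hw₁, rfl⟩ p hpseg
  by_contra hp
  have hp' : ∀ z ∈ K, ∀ w ∈ K, z * w ≠ p := fun z hz w hw h => hp (h ▸ Set.mul_mem_mul hz hw)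
  have hmulL : ∀ w : ℂ, Convex ℝ ((fun z => z * w) '' K) := fun w =>
    hK.is_linear_image (IsLinearMap.mk (fun x y => by ring) (fun c x => by simp [mul_assoc]))
  obtain ⟨θ, hθ, θab, hang⟩ := exists_continuousOn_angle_mul hK haK hbK hp'
  have hc : (a * b - p)⁻¹ ≠ 0 := inv_ne_zero (sub_ne_zero.2 (hp' a haK b hbK))
  have hslice1 : ∀ w ∈ K, ContinuousOn (fun z => θ (z, w)) K := fun w hw =>
    hθ.comp (by fun_prop) fun z hz => ⟨hz, hw⟩
  have hslice2 : ∀ z ∈ K, ContinuousOn (fun w => θ (z, w)) K := fun z hz =>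
    hθ.comp (by fun_prop) fun w hw => ⟨hz, hw⟩
  have hlt1 : ∀ w ∈ K, ∀ z ∈ K, ∀ z' ∈ K, |θ (z', w) - θ (z, w)| < Real.pi := by
    intro w hw z hz z' hz'
    refine abs_angle_sub_lt_pi (f := fun z => z * w) (θ := fun z => θ (z, w)) hK.isPreconnected
      (by fun_prop) (hmulL w) (Set.mapsTo_image _ _) ?_ (hslice1 w hw) hc
      (fun u hu => hang u hu w hw) hz hz'
    rintro ⟨u, hu, hu'⟩
    exact hp' u hu w hw hu'
  have hang2 : ∀ z ∈ K, ∀ w ∈ K, (w * z - p) * (a * b - p)⁻¹ =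
      ‖(w * z - p) * (a * b - p)⁻¹‖ * Complex.exp (θ (z, w) * Complex.I) := fun z hz w hw => by
    rw [mul_comm w z]; exact hang z hz w hw
  have hlt2 : ∀ z ∈ K, ∀ w ∈ K, ∀ w' ∈ K, |θ (z, w') - θ (z, w)| < Real.pi := by
    intro z hz w hw w' hw'
    refine abs_angle_sub_lt_pi (f := fun w => w * z) (θ := fun w => θ (z, w)) hK.isPreconnected
      (by fun_prop) (hmulL z) (Set.mapsTo_image _ _) ?_ (hslice2 z hz) hc
      (fun u hu => hang2 z hz u hu) hw hw'
    rintro ⟨u, hu, hu'⟩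
    exact hp' u hu z hz hu'
  have hdiag : ∀ z ∈ K, ∀ z' ∈ K, |θ (z', starRingEnd ℂ z') - θ (z, starRingEnd ℂ z)| < Real.pi ∧
      θ (z', starRingEnd ℂ z') - θ (z, starRingEnd ℂ z) =
        Complex.arg ((z' * starRingEnd ℂ z' - p) / (z * starRingEnd ℂ z - p)) := by
    intro z hz z' hz'
    -- On the twisted diagonal the product is not affine in z, but its values form a real interval,
    -- which is convex.
    have hC : Convex ℝ (Complex.ofReal '' (Complex.normSq '' K)) :=
      (convex_iff_ordConnected.2 (hK.isPreconnected.image _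
        Complex.continuous_normSq.continuousOn).ordConnected).is_linear_image
        (IsLinearMap.mk (fun x y => by simp) (fun c x => by simp))
    have hm : Set.MapsTo (fun z => z * starRingEnd ℂ z) K
        (Complex.ofReal '' (Complex.normSq '' K)) := fun u hu =>
      ⟨_, ⟨u, hu, rfl⟩, (Complex.mul_conj u).symm⟩
    have hpC : p ∉ Complex.ofReal '' (Complex.normSq '' K) := by
      rintro ⟨_, ⟨u, hu, rfl⟩, hu'⟩
      exact hp' u hu _ (hconj u hu) ((Complex.mul_conj u).trans hu')
    have hcd : ContinuousOn (fun z => θ (z, starRingEnd ℂ z)) K :=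
      hθ.comp (continuousOn_id.prodMk Complex.continuous_conj.continuousOn)
        fun u hu => ⟨hu, hconj u hu⟩
    have hcf : ContinuousOn (fun z : ℂ => z * starRingEnd ℂ z) K :=
      continuousOn_id.mul Complex.continuous_conj.continuousOn
    exact ⟨abs_angle_sub_lt_pi (θ := fun z => θ (z, starRingEnd ℂ z)) hK.isPreconnected hcf hC hm
        hpC hcd hc (fun u hu => hang u hu _ (hconj u hu)) hz hz',
      angle_sub_eq_arg (θ := fun z => θ (z, starRingEnd ℂ z)) hK.isPreconnected hcf hC hm
        hpC hcd hc (fun u hu => hang u hu _ (hconj u hu)) hz hz'⟩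
  have hn0 : a * b - p ≠ 0 := sub_ne_zero.2 (hp' a haK b hbK)
  have hbb : starRingEnd ℂ b = a := by simp [hb]
  have θba : θ (b, a) = 0 := by
    have := (hdiag a haK b hbK).2
    rw [hbb, ← hb, θab, mul_comm b a, div_self hn0] at this
    simpa using this
  have θrr : |θ (r, r)| < Real.pi := by
    have := (hdiag a haK r hrK).1
    rwa [← hb, θab, Complex.conj_ofReal, sub_zero] at this
  have hrow_a : ∀ w ∈ K, |θ (a, w)| < Real.pi := fun w hw => by
    simpa [θab] using hlt2 a haK b hbK w hw
  have hrow_b : ∀ w ∈ K, |θ (b, w)| < Real.pi := fun w hw => by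
    simpa [θba] using hlt2 b hbK a haK w hw
  have hcol_a : ∀ z ∈ K, |θ (z, a)| < Real.pi := fun z hz => by
    simpa [θba] using hlt1 a haK b hbK z hz
  have hcol_b : ∀ z ∈ K, |θ (z, b)| < Real.pi := fun z hz => by
    simpa [θab] using hlt1 b hbK a haK z hz
  -- The row at r is bounded at its three vertices: by the diagonal at (r, r), and by the columns at
  -- a and b.
  have hrow_r : ∀ w ∈ K, |θ (r, w)| < Real.pi := fun w hw =>
    (triangleHull_subset (convex_setOf_abs_angle_lt hK (w := r)
      (fun u hu h => hp' u hu r hrK h) (hslice2 r hrK) hc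
      (fun u hu => hang2 r hrK u hu) Real.pi) ⟨hrK, θrr⟩ ⟨haK, hcol_a r hrK⟩
      ⟨hbK, hcol_b r hrK⟩ hw).2
  have hall : |θ (z₁, w₁)| < Real.pi :=
    (triangleHull_subset (convex_setOf_abs_angle_lt hK (w := w₁)
      (fun u hu => hp' u hu w₁ hw₁) (hslice1 w₁ hw₁) hc
      (fun u hu => hang u hu w₁ hw₁) Real.pi) ⟨hrK, hrow_r w₁ hw₁⟩ ⟨haK, hrow_a w₁ hw₁⟩
      ⟨hbK, hrow_b w₁ hw₁⟩ hz₁).2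
  -- but `p` lies between `a * b` and `z₁ * w₁`, so the angle is an odd multiple of `π`
  obtain ⟨s, t, hs, ht, hst, hpt⟩ := hpseg
  have hst' : (s : ℂ) + t = 1 := by exact_mod_cast hst
  -- The normalized value at (z₁, w₁) is a nonpositive real, whereas |θ| < π and sin θ = 0 will give
  -- θ = 0 and a positive value.
  have e1 : (t : ℂ) * ((z₁ * w₁ - p) * (a * b - p)⁻¹) = -s := by
    rw [Complex.real_smul, Complex.real_smul] at hpt
    field_simp
    linear_combination hpt - p * hst'
  have ht0 : t ≠ 0 := by
    rintro rfl
    have : s = 0 := by simpa using e1.symm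
    simp [this] at hst
  have tpos : 0 < t := ht.lt_of_ne' ht0
  set N := ‖(z₁ * w₁ - p) * (a * b - p)⁻¹‖ with hN
  have hNpos : 0 < N := by
    rw [hN]
    exact norm_pos_iff.2 (mul_ne_zero (sub_ne_zero.2 (hp' z₁ hz₁ w₁ hw₁)) hc)
  have e2 := hang z₁ hz₁ w₁ hw₁
  rw [e2] at e1
  have ere := congrArg Complex.re e1
  have eim := congrArg Complex.im e1
  rw [← mul_assoc, ← hN, ← Complex.ofReal_mul, Complex.re_ofReal_mul,
    Complex.exp_ofReal_mul_I_re] at ere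
  rw [← mul_assoc, ← hN, ← Complex.ofReal_mul, Complex.im_ofReal_mul,
    Complex.exp_ofReal_mul_I_im] at eim
  simp only [Complex.neg_re, Complex.neg_im, Complex.ofReal_re, Complex.ofReal_im, neg_zero] at ere eim
  have hprod : 0 < t * N := by positivity
  have hsin : Real.sin (θ (z₁, w₁)) = 0 := by
    rcases mul_eq_zero.1 eim with h | h
    · exact absurd h hprod.ne'
    · exact h
  rw [Real.sin_eq_zero_iff_of_lt_of_lt (abs_lt.1 hall).1 (abs_lt.1 hall).2] at hsin
  rw [hsin, Real.cos_zero] at ere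
  linarith

/-! ### Vertices of a triangle set symmetric about the real axis -/

/-- Conjugation permutes the extreme points, of which there are at most three. If all are real, K is
a real segment. Otherwise two of them form a conjugate pair, and a third one must be fixed by
conjugation. -/
theorem exists_eq_triangleHull_conj {K : Set ℂ} (hK : IsTriangleSet K)
    (hconj : (starRingEnd ℂ) '' K = K) :
    ∃ (r : ℝ) (a : ℂ), K = triangleHull (r : ℂ) a (starRingEnd ℂ a) := by
  obtain ⟨z₁, z₂, z₃, hz⟩ := hK
  have hKc : Convex ℝ K := hz ▸ convex_convexHull ℝ _
  have h₁ : z₁ ∈ K := hz ▸ subset_convexHull ℝ _ (by simp)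
  have h₂ : z₂ ∈ K := hz ▸ subset_convexHull ℝ _ (by simp)
  have h₃ : z₃ ∈ K := hz ▸ subset_convexHull ℝ _ (by simp)
  have hfin : ({z₁, z₂, z₃} : Set ℂ).Finite := by simp
  set E := K.extremePoints ℝ with hE
  have hEsub : E ⊆ {z₁, z₂, z₃} := by
    rw [hE, hz]; exact extremePoints_convexHull_subset
  have hEK : E ⊆ K := extremePoints_subset
  have hEhull : convexHull ℝ E = K := by
    have h := closure_convexHull_extremePoints (s := K)
      (hz ▸ hfin.isCompact_convexHull ℝ) hKc
    rwa [((hfin.subset hEsub).isClosed_convexHull ℝ).closure_eq] at h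
  have hcE : ∀ z ∈ E, starRingEnd ℂ z ∈ E := by
    intro z hzE
    have h := image_extremePoints (𝕜 := ℝ) Complex.conjAe.toLinearEquiv K
    have h' : (Complex.conjAe.toLinearEquiv : ℂ → ℂ) '' K = K := hconj
    rw [h'] at h
    rw [hE, ← h]
    exact ⟨z, hzE, rfl⟩
  by_cases hreal : ∀ z ∈ E, z.im = 0
  · have hKreal : ∀ z ∈ K, z.im = 0 := by
      have hC : Convex ℝ {z : ℂ | z.im = 0} := by
        intro x hx y hy s t _ _ _
        simp only [Set.mem_ofPred_eq] at hx hy ⊢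
        simp [hx, hy]
      intro z hzK
      rw [← hEhull] at hzK
      exact convexHull_min hreal hC hzK
    have ext : ∀ z ∈ K, ((z.re : ℝ) : ℂ) = z := fun z hzK =>
      Complex.ext (by simp) (by simp [hKreal z hzK])
    have hmin : ((min z₁.re (min z₂.re z₃.re) : ℝ) : ℂ) ∈ K := by
      rcases min_choice z₁.re (min z₂.re z₃.re) with h | h <;> rw [h]
      · rwa [ext z₁ h₁]
      · rcases min_choice z₂.re z₃.re with h | h <;> rw [h]
        · rwa [ext z₂ h₂]
        · rwa [ext z₃ h₃]
    have hmax : ((max z₁.re (max z₂.re z₃.re) : ℝ) : ℂ) ∈ K := by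
      rcases max_choice z₁.re (max z₂.re z₃.re) with h | h <;> rw [h]
      · rwa [ext z₁ h₁]
      · rcases max_choice z₂.re z₃.re with h | h <;> rw [h]
        · rwa [ext z₂ h₂]
        · rwa [ext z₃ h₃]
    set p := min z₁.re (min z₂.re z₃.re) with hp
    set q := max z₁.re (max z₂.re z₃.re) with hq
    refine ⟨p, q, ?_⟩
    rw [Complex.conj_ofReal]
    have hmem : ∀ z ∈ K, p ≤ z.re → z.re ≤ q → z ∈ triangleHull (p : ℂ) q q := by
      intro z hzK hpz hzq
      have hs : z.re ∈ segment ℝ p q := by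
        rw [segment_eq_Icc (hpz.trans hzq)]; exact ⟨hpz, hzq⟩
      obtain ⟨s, t, hs, ht, hst, e⟩ := hs
      have : z = s • (p : ℂ) + t • (q : ℂ) := by
        rw [← ext z hzK, ← e]
        simp
      rw [this]
      exact convex_convexHull ℝ _ (subset_convexHull ℝ _ (by simp))
        (subset_convexHull ℝ _ (by simp)) hs ht hst
    apply Set.Subset.antisymm
    · have : triangleHull z₁ z₂ z₃ ⊆ triangleHull (p : ℂ) q q :=
        triangleHull_subset (convex_convexHull ℝ _)
          (hmem z₁ h₁ (by simp [hp]) (by simp [hq]))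
          (hmem z₂ h₂ (by simp [hp]) (by simp [hq]))
          (hmem z₃ h₃ (by simp [hp]) (by simp [hq]))
      rwa [← hz] at this
    · exact triangleHull_subset hKc hmin hmax hmax
  · push Not at hreal
    obtain ⟨a, haE, ha⟩ := hreal
    have hbE := hcE a haE
    have hab : starRingEnd ℂ a ≠ a := fun h => ha (Complex.conj_eq_iff_im.1 h)
    obtain ⟨c, hc⟩ : ∃ c, E ⊆ {a, starRingEnd ℂ a, c} := by
      have ha' := hEsub haE
      have hb' := hEsub hbE
      simp only [Set.mem_insert_iff, Set.mem_singleton_iff] at ha' hb'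
      have key : ∃ c, ∀ z, (z = z₁ ∨ z = z₂ ∨ z = z₃) → z = a ∨ z = starRingEnd ℂ a ∨ z = c := by
        rcases ha' with h | h | h <;> rcases hb' with h' | h' | h'
        · exact absurd (h'.trans h.symm) hab
        · exact ⟨z₃, fun z hz => by rw [h', h]; tauto⟩
        · exact ⟨z₂, fun z hz => by rw [h', h]; tauto⟩
        · exact ⟨z₃, fun z hz => by rw [h', h]; tauto⟩
        · exact absurd (h'.trans h.symm) hab
        · exact ⟨z₁, fun z hz => by rw [h', h]; tauto⟩
        · exact ⟨z₂, fun z hz => by rw [h', h]; tauto⟩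
        · exact ⟨z₁, fun z hz => by rw [h', h]; tauto⟩
        · exact absurd (h'.trans h.symm) hab
      obtain ⟨c, hc⟩ := key
      exact ⟨c, fun z hzE => hc z (hEsub hzE)⟩
    have fin : ∀ r : ℝ, (r : ℂ) ∈ K → E ⊆ {(r : ℂ), a, starRingEnd ℂ a} →
        K = triangleHull (r : ℂ) a (starRingEnd ℂ a) := by
      intro r hr hsub
      apply Set.Subset.antisymm
      · rw [← hEhull]; exact convexHull_mono hsub
      · exact triangleHull_subset hKc hr (hEK haE) (hEK hbE)
    by_cases hcE' : c ∈ E ∧ c ≠ a ∧ c ≠ starRingEnd ℂ a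
    · obtain ⟨hc1, hc2, hc3⟩ := hcE'
      have hcr : ((c.re : ℝ) : ℂ) = c := by
        rcases hc (hcE c hc1) with h | h | h
        · exact absurd (by rw [← h, Complex.conj_conj]) hc3
        · exact absurd ((starRingEnd ℂ).injective h) hc2
        · exact Complex.conj_eq_iff_re.1 h
      refine ⟨c.re, a, fin _ (hcr.symm ▸ hEK hc1) ?_⟩
      rw [hcr]
      intro z hzE
      rcases hc hzE with h | h | h <;> simp_all
    -- With no third extreme point, K is the segment from a to its conjugate, and its midpoint
    -- serves as r.
    · refine ⟨a.re, a, fin _ ?_ ?_⟩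
      · have : ((a.re : ℝ) : ℂ) = (1 / 2 : ℝ) • a + (1 / 2 : ℝ) • starRingEnd ℂ a := by
          apply Complex.ext <;> simp <;> ring
        rw [this]
        exact hKc (hEK haE) (hEK hbE) (by norm_num) (by norm_num) (by norm_num)
      · intro z hzE
        rcases hc hzE with h | h | h
        · simp [h]
        · simp [h]
        · have h : z = c := h
          subst h
          by_cases h1 : z = a
          · simp [h1]
          · by_cases h2 : z = starRingEnd ℂ a
            · simp [h2]
            · exact absurd ⟨hzE, h1, h2⟩ hcE'

/-! ### Numerical ranges and diagonalization -/

lemma numRange_conj_unitary {n : ℕ} (A U : Matrix (Fin n) (Fin n) ℂ)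
    (hU : U ∈ Matrix.unitaryGroup (Fin n) ℂ) : numRange (star U * A * U) = numRange A := by
  have aux : ∀ (B V : Matrix (Fin n) (Fin n) ℂ), V ∈ Matrix.unitaryGroup (Fin n) ℂ →
      numRange (star V * B * V) ⊆ numRange B := by
    rintro B V hV z ⟨x, hx, rfl⟩
    have h1 : star V * V = 1 := (Matrix.mem_unitaryGroup_iff').1 hV
    have key : ∀ C : Matrix (Fin n) (Fin n) ℂ,
        star (V.mulVec x) ⬝ᵥ C.mulVec (V.mulVec x) = star x ⬝ᵥ (star V * C * V).mulVec x := by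
      intro C
      rw [Matrix.star_mulVec, ← Matrix.dotProduct_mulVec, Matrix.mulVec_mulVec,
        Matrix.mulVec_mulVec, Matrix.star_eq_conjTranspose]
    refine ⟨V.mulVec x, ?_, (key B).symm⟩
    have := key 1
    rw [Matrix.one_mulVec, mul_one, h1, Matrix.one_mulVec, hx] at this
    exact this
  apply Set.Subset.antisymm (aux A U hU)
  have h2 : U * star U = 1 := (Matrix.mem_unitaryGroup_iff).1 hU
  have h := aux (star U * A * U) (star U) (Unitary.star_mem hU)
  have e : star (star U) * (star U * A * U) * star U = A := by
    rw [star_star]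
    calc U * (star U * A * U) * star U = (U * star U) * A * (U * star U) := by noncomm_ring
      _ = A := by rw [h2, one_mul, mul_one]
  rwa [e] at h

/-- A unit vector x yields the convex combination of the entries with weights |xᵢ|², and square
roots realize every choice of weights. -/
lemma numRange_diagonal (d : Fin 3 → ℂ) :
    numRange (Matrix.diagonal d) = triangleHull (d 0) (d 1) (d 2) := by
  have hcalc : ∀ x : Fin 3 → ℂ, star x ⬝ᵥ (Matrix.diagonal d).mulVec x =
      ∑ i, (Complex.normSq (x i)) • d i := by
    intro x
    simp only [dotProduct, Matrix.mulVec_diagonal, Pi.star_apply]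
    refine Finset.sum_congr rfl fun i _ => ?_
    rw [Complex.real_smul, ← Complex.mul_conj]
    simp only [starRingEnd_apply]
    ring
  have hone : ∀ x : Fin 3 → ℂ, star x ⬝ᵥ x = ((∑ i, Complex.normSq (x i) : ℝ) : ℂ) := by
    intro x
    simp only [dotProduct, Pi.star_apply]
    push_cast
    refine Finset.sum_congr rfl fun i _ => ?_
    rw [← Complex.mul_conj]
    simp only [starRingEnd_apply]
    ring
  apply Set.Subset.antisymm
  · rintro z ⟨x, hx, rfl⟩
    rw [hcalc]
    rw [hone] at hx
    refine (convex_convexHull ℝ _).sum_mem (fun i _ => Complex.normSq_nonneg _)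
      (by exact_mod_cast hx) fun i _ => subset_convexHull ℝ _ ?_
    fin_cases i <;> simp
  · have hsub : {z : ℂ | ∃ w : Fin 3 → ℝ, (∀ i, 0 ≤ w i) ∧ ∑ i, w i = 1 ∧ z = ∑ i, w i • d i} ⊆
        numRange (Matrix.diagonal d) := by
      rintro z ⟨w, hw, hw1, rfl⟩
      have hn : ∀ i, Complex.normSq ((Real.sqrt (w i) : ℝ) : ℂ) = w i := fun i => by
        rw [Complex.normSq_ofReal, Real.mul_self_sqrt (hw i)]
      refine ⟨fun i => (Real.sqrt (w i) : ℝ), ?_, ?_⟩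
      · rw [hone]; simp only [hn, hw1, Complex.ofReal_one]
      · rw [hcalc]; simp only [hn]
    refine Set.Subset.trans (triangleHull_subset ?_ ?_ ?_ ?_) hsub
    · rintro x ⟨v, hv, hv1, rfl⟩ y ⟨w, hw, hw1, rfl⟩ s t hs ht hst
      refine ⟨fun i => s * v i + t * w i, fun i => ?_, ?_, ?_⟩
      · have := hv i; have := hw i; positivity
      · rw [Finset.sum_add_distrib, ← Finset.mul_sum, ← Finset.mul_sum, hv1, hw1]; linarith
      · simp only [add_smul, mul_smul, Finset.sum_add_distrib, Finset.smul_sum]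
    · exact ⟨Pi.single 0 1, by intro i; fin_cases i <;> simp, by simp, by
        simp [Fin.sum_univ_three]⟩
    · exact ⟨Pi.single 1 1, by intro i; fin_cases i <;> simp, by simp, by
        simp [Fin.sum_univ_three]⟩
    · exact ⟨Pi.single 2 1, by intro i; fin_cases i <;> simp, by simp, by
        simp [Fin.sum_univ_three]⟩

lemma numRange_eq_triangleHull {A U : Matrix (Fin 3) (Fin 3) ℂ} {d : Fin 3 → ℂ}
    (hU : U ∈ Matrix.unitaryGroup (Fin 3) ℂ) (h : star U * A * U = Matrix.diagonal d) :
    numRange A = triangleHull (d 0) (d 1) (d 2) := by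
  rw [← numRange_conj_unitary A U hU, h, numRange_diagonal]

lemma spectrum_eq_of_unitary_diagonal {n : Type*} [Fintype n] [DecidableEq n]
    {A U : Matrix n n ℂ} {d : n → ℂ}
    (hU : U ∈ Matrix.unitaryGroup n ℂ) (h : star U * A * U = Matrix.diagonal d) :
    spectrum ℂ A = Set.range d := by
  rw [← spectrum_diagonal (R := ℂ) d, ← h]
  exact (Unitary.spectrum_star_left_conjugate (R := ℂ) (a := A) (U := ⟨U, hU⟩)).symm

/-- The product is a connected subset of the real line, as a continuous image of K × K, hence an
interval. -/
lemma convex_mul_self_of_real {K : Set ℂ} (hK : Convex ℝ K) (hre : ∀ z ∈ K, z.im = 0) :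
    Convex ℝ (K * K) := by
  have hpre : IsPreconnected (K * K) := by
    rw [← Set.image_mul_prod]
    exact (hK.isPreconnected.prod hK.isPreconnected).image _ continuous_mul.continuousOn
  have hC : Convex ℝ (Complex.re '' (K * K)) := convex_iff_ordConnected.2
    (hpre.image _ Complex.continuous_re.continuousOn).ordConnected
  have : K * K = Complex.ofReal '' (Complex.re '' (K * K)) := by
    rw [Set.image_image]
    symm
    refine (Set.image_congr ?_).trans (Set.image_id _)
    rintro _ ⟨z, hz, w, hw, rfl⟩
    apply Complex.ext <;> simp [hre z hz, hre w hw]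
  rw [this]
  exact hC.is_linear_image (IsLinearMap.mk (fun x y => by simp) (fun c x => by simp))

lemma convex_numRange_mul_self_of_isHermitian {A : Matrix (Fin 3) (Fin 3) ℂ}
    (hA : A.IsHermitian) : Convex ℝ (numRange A * numRange A) := by
  have h := hA.conjStarAlgAut_star_eigenvectorUnitary
  rw [Unitary.conjStarAlgAut_star_apply] at h
  rw [numRange_eq_triangleHull hA.eigenvectorUnitary.2 h]
  refine convex_mul_self_of_real (convex_convexHull ℝ _) fun z hz => ?_
  have hC : Convex ℝ {z : ℂ | z.im = 0} := by
    intro x hx y hy s t _ _ _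
    simp only [Set.mem_ofPred_eq] at hx hy ⊢
    simp [hx, hy]
  exact triangleHull_subset hC (by simp) (by simp) (by simp) hz

/-! ### Normal form of a real normal non-symmetric 3 × 3 matrix -/

/-- The vector k is the axis of the skew part: (A - Aᵀ)x = k × x. Thus Ak = Aᵀk, and normality gives
k × Ak = (A - Aᵀ)Ak = 0, so Ak is parallel to k. -/
lemma exists_common_eigenvector {A : Matrix (Fin 3) (Fin 3) ℝ} (hA : IsStarNormal A)
    (hne : ¬ A.IsHermitian) :
    ∃ (k : Fin 3 → ℝ) (r : ℝ), k ≠ 0 ∧ A.mulVec k = r • k ∧ A.transpose.mulVec k = r • k := by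
  have hn : A.transpose * A = A * A.transpose := by
    have := hA.star_comm_self.eq
    rwa [Matrix.star_eq_conjTranspose, Matrix.conjTranspose_eq_transpose_of_trivial] at this
  have e := fun i j => congrFun (congrFun hn i) j
  simp only [Matrix.mul_apply, Matrix.transpose_apply, Fin.sum_univ_three] at e
  set k : Fin 3 → ℝ := ![A 2 1 - A 1 2, A 0 2 - A 2 0, A 1 0 - A 0 1] with hk
  have hT : A.transpose.mulVec k = A.mulVec k := by
    ext i
    fin_cases i <;>
    simp [hk, Matrix.mulVec, dotProduct, Fin.sum_univ_three] <;> ring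
  have hk0 : k ≠ 0 := by
    intro h0
    have h1 := congrFun h0 0
    have h2 := congrFun h0 1
    have h3 := congrFun h0 2
    simp [hk] at h1 h2 h3
    apply hne
    ext i j
    fin_cases i <;> fin_cases j <;> simp [Matrix.conjTranspose_apply] <;> linarith
  have hpar : ∀ i j, k i * A.mulVec k j = k j * A.mulVec k i := by
    have h01 : k 0 * A.mulVec k 1 = k 1 * A.mulVec k 0 := by
      simp only [hk, Matrix.mulVec, dotProduct, Fin.sum_univ_three, Matrix.cons_val]
      -- Up to sign, each coordinate of k × Ak is a row of AᵀA - AAᵀ applied to k.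
      linear_combination (-1 : ℝ) * (e 2 0 * (A 2 1 - A 1 2) + e 2 1 * (A 0 2 - A 2 0) +
        e 2 2 * (A 1 0 - A 0 1))
    have h02 : k 0 * A.mulVec k 2 = k 2 * A.mulVec k 0 := by
      simp only [hk, Matrix.mulVec, dotProduct, Fin.sum_univ_three, Matrix.cons_val]
      linear_combination (1 : ℝ) * (e 1 0 * (A 2 1 - A 1 2) + e 1 1 * (A 0 2 - A 2 0) +
        e 1 2 * (A 1 0 - A 0 1))
    have h12 : k 1 * A.mulVec k 2 = k 2 * A.mulVec k 1 := by
      simp only [hk, Matrix.mulVec, dotProduct, Fin.sum_univ_three, Matrix.cons_val]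
      linear_combination (-1 : ℝ) * (e 0 0 * (A 2 1 - A 1 2) + e 0 1 * (A 0 2 - A 2 0) +
        e 0 2 * (A 1 0 - A 0 1))
    intro i j
    fin_cases i <;> fin_cases j
    exacts [rfl, h01, h02, h01.symm, rfl, h12, h02.symm, h12.symm, rfl]
  obtain ⟨i, hi⟩ := Function.ne_iff.1 hk0
  have hi : k i ≠ 0 := hi
  have hr : A.mulVec k = (A.mulVec k i / k i) • k := by
    ext j
    have := hpar i j
    simp only [Pi.smul_apply, smul_eq_mul]
    field_simp
    linarith
  exact ⟨k, _, hk0, hr, hT.trans hr⟩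

/-- A real normal non-symmetric matrix is orthogonally similar to the direct sum of a real number
and a scaled planar rotation. -/
lemma exists_orthogonal_block {A : Matrix (Fin 3) (Fin 3) ℝ} (hA : IsStarNormal A)
    (hne : ¬ A.IsHermitian) :
    ∃ (Q : Matrix (Fin 3) (Fin 3) ℝ) (r x y : ℝ), Q.transpose * Q = 1 ∧ y ≠ 0 ∧
      Q.transpose * A * Q = !![r, 0, 0; 0, x, -y; 0, y, x] := by
  obtain ⟨k, r, hk0, hAk, hATk⟩ := exists_common_eigenvector hA hne
  set v : EuclideanSpace ℝ (Fin 3) := WithLp.toLp 2 k with hv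
  have hv0 : v ≠ 0 := by
    intro h; apply hk0; ext i; simpa [hv] using congrArg (fun w : EuclideanSpace ℝ (Fin 3) => w i) h
  have hvn : ‖v‖ ≠ 0 := norm_ne_zero_iff.2 hv0
  set u : EuclideanSpace ℝ (Fin 3) := ‖v‖⁻¹ • v with hu
  obtain ⟨b, hb⟩ := Orthonormal.exists_orthonormalBasis_extension_of_card_eq (𝕜 := ℝ)
    (E := EuclideanSpace ℝ (Fin 3)) (ι := Fin 3) (by simp) (v := fun _ => u) (s := {0}) (by
      constructor
      · rintro ⟨i, hi⟩
        simp only [Set.domRestrict_apply, hu, norm_smul, norm_inv, norm_norm]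
        exact inv_mul_cancel₀ hvn
      · rintro ⟨i, hi⟩ ⟨j, hj⟩ hij
        exact absurd (Subtype.ext ((Set.mem_singleton_iff.1 hi).trans
          (Set.mem_singleton_iff.1 hj).symm)) hij)
  have hb0 : b 0 = u := hb 0 rfl
  set Q : Matrix (Fin 3) (Fin 3) ℝ := Matrix.of fun i j => b j i with hQ
  have hQQ : Q.transpose * Q = 1 := by
    ext i j
    have := (orthonormal_iff_ite.1 b.orthonormal) i j
    rw [Matrix.mul_apply, Matrix.one_apply, ← this, PiLp.inner_apply]
    simp [hQ, mul_comm]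
  have hQQ' : Q * Q.transpose = 1 := mul_eq_one_comm.1 hQQ
  have hcol : ∀ i, Q i 0 = ‖v‖⁻¹ * k i := fun i => by
    simp [hQ, hb0, hu, hv]
  have hcol' : ∀ M : Matrix (Fin 3) (Fin 3) ℝ, M.mulVec k = r • k →
      ∀ i, (M * Q) i 0 = r * Q i 0 := by
    intro M hM i
    have h := congrFun hM i
    simp only [Matrix.mulVec, dotProduct, Pi.smul_apply, smul_eq_mul] at h
    rw [Matrix.mul_apply, hcol]
    simp only [hcol]
    rw [show r * (‖v‖⁻¹ * k i) = ‖v‖⁻¹ * (r * k i) by ring, ← h, Finset.mul_sum]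
    exact Finset.sum_congr rfl fun j _ => by ring
  set B := Q.transpose * A * Q with hB
  have hBcol : ∀ M : Matrix (Fin 3) (Fin 3) ℝ, M.mulVec k = r • k →
      ∀ i, (Q.transpose * M * Q) i 0 = r * (1 : Matrix (Fin 3) (Fin 3) ℝ) i 0 := by
    intro M hM i
    rw [Matrix.mul_assoc, Matrix.mul_apply, ← hQQ, Matrix.mul_apply, Finset.mul_sum]
    exact Finset.sum_congr rfl fun j _ => by rw [hcol' M hM]; ring
  have hBT : B.transpose = Q.transpose * A.transpose * Q := by
    simp [hB, Matrix.transpose_mul, Matrix.mul_assoc]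
  have h00 : B 0 0 = r := by simpa using hBcol A hAk 0
  have h10 : B 1 0 = 0 := by simpa using hBcol A hAk 1
  have h20 : B 2 0 = 0 := by simpa using hBcol A hAk 2
  have h01 : B 0 1 = 0 := by
    have := hBcol _ hATk 1
    rw [← hBT] at this
    simpa using this
  have h02 : B 0 2 = 0 := by
    have := hBcol _ hATk 2
    rw [← hBT] at this
    simpa using this
  have hnA : A.transpose * A = A * A.transpose := by
    have := hA.star_comm_self.eq
    rwa [Matrix.star_eq_conjTranspose, Matrix.conjTranspose_eq_transpose_of_trivial] at this
  have hnB : B.transpose * B = B * B.transpose := by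
    rw [hBT]
    calc Q.transpose * A.transpose * Q * B
        = Q.transpose * A.transpose * (Q * Q.transpose) * A * Q := by
          rw [hB]; simp only [Matrix.mul_assoc]
      _ = Q.transpose * (A.transpose * A) * Q := by
          rw [hQQ', mul_one]; simp only [Matrix.mul_assoc]
      _ = Q.transpose * A * (Q * Q.transpose) * A.transpose * Q := by
          rw [hQQ', hnA, mul_one]; simp only [Matrix.mul_assoc]
      _ = B * (Q.transpose * A.transpose * Q) := by
          rw [hB]; simp only [Matrix.mul_assoc]
  have hBns : B 1 2 ≠ B 2 1 := by
    intro h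
    have hsymm : B.transpose = B := by
      ext i j
      fin_cases i <;> fin_cases j <;> simp [Matrix.transpose_apply, h10, h20, h01, h02, h]
    apply hne
    have hrec : ∀ M : Matrix (Fin 3) (Fin 3) ℝ,
        Q * (Q.transpose * M * Q) * Q.transpose = M := fun M => by
      calc Q * (Q.transpose * M * Q) * Q.transpose
          = (Q * Q.transpose) * M * (Q * Q.transpose) := by simp only [Matrix.mul_assoc]
        _ = M := by rw [hQQ', one_mul, mul_one]
    rw [Matrix.IsHermitian, Matrix.conjTranspose_eq_transpose_of_trivial, ← hrec A.transpose,
      ← hBT, hsymm, hB, hrec]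
  have e11 := congrFun (congrFun hnB 1) 1
  have e12 := congrFun (congrFun hnB 1) 2
  simp only [Matrix.mul_apply, Matrix.transpose_apply, Fin.sum_univ_three, h01, h02, h10, h20]
    at e11 e12
  -- The two entries of the normality identity factor, each with the factor B₁₂ - B₂₁, which is
  -- nonzero because A is not symmetric.
  have h12 : B 1 2 = - B 2 1 := by
    have : (B 1 2 - B 2 1) * (B 1 2 + B 2 1) = 0 := by linarith
    rcases mul_eq_zero.1 this with h | h
    · exact absurd (sub_eq_zero.1 h) hBns
    · linarith
  have h22 : B 2 2 = B 1 1 := by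
    have : (B 1 2 - B 2 1) * (B 2 2 - B 1 1) = 0 := by linarith
    rcases mul_eq_zero.1 this with h | h
    · exact absurd (sub_eq_zero.1 h) hBns
    · linarith
  refine ⟨Q, r, B 1 1, B 2 1, hQQ, fun h => hBns (by rw [h12, h, neg_zero]), ?_⟩
  rw [← hB]
  ext i j
  fin_cases i <;> fin_cases j <;> simp [h00, h10, h20, h01, h02, h12, h22]

lemma exists_unitary_diagonal {A : Matrix (Fin 3) (Fin 3) ℝ} (hA : IsStarNormal A)
    (hne : ¬ A.IsHermitian) :
    ∃ U ∈ Matrix.unitaryGroup (Fin 3) ℂ, ∃ (r : ℝ) (a : ℂ), a.im ≠ 0 ∧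
      star U * toComplexMatrix A * U = Matrix.diagonal ![(r : ℂ), a, starRingEnd ℂ a] := by
  obtain ⟨Q, r, x, y, hQ, hy, hB⟩ := exists_orthogonal_block hA hne
  set s : ℂ := (((Real.sqrt 2)⁻¹ : ℝ) : ℂ) with hs
  have hss : s * s = 1 / 2 := by
    rw [hs, ← Complex.ofReal_mul, ← mul_inv, Real.mul_self_sqrt (by norm_num)]
    norm_num
  have hsc : starRingEnd ℂ s = s := Complex.conj_ofReal _
  -- The last two columns are the normalized eigenvectors (1, ±i) of the planar block; (1, i)
  -- belongs to x - iy, whence the choice of a below.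
  set V : Matrix (Fin 3) (Fin 3) ℂ := !![1, 0, 0; 0, s, s; 0, s * Complex.I, -(s * Complex.I)]
    with hV
  have hVs : star V = !![1, 0, 0; 0, s, -(s * Complex.I); 0, s, s * Complex.I] := by
    ext i j
    fin_cases i <;> fin_cases j <;> simp [hV, Matrix.star_apply, hsc]
  set P : Matrix (Fin 3) (Fin 3) ℂ := toComplexMatrix Q with hP
  have hmul : ∀ M N : Matrix (Fin 3) (Fin 3) ℝ,
      toComplexMatrix (M * N) = toComplexMatrix M * toComplexMatrix N := fun M N =>
    Matrix.map_mul (f := Complex.ofRealHom)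
  have hPs : star P = toComplexMatrix Q.transpose := by
    ext i j
    simp [hP, toComplexMatrix, Matrix.star_apply]
  have hPP : star P * P = 1 := by
    rw [hPs, hP, ← hmul, hQ]
    ext i j
    simp [toComplexMatrix, Matrix.one_apply, apply_ite]
  have hPB : star P * toComplexMatrix A * P = toComplexMatrix !![r, 0, 0; 0, x, -y; 0, y, x] := by
    rw [hPs, hP, ← hmul, ← hmul, hB]
  have hI := Complex.I_mul_I
  have hVV : star V * V = 1 := by
    rw [hVs, hV]
    ext i j
    fin_cases i <;> fin_cases j <;> simp [Matrix.mul_apply, Fin.sum_univ_three]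
    · linear_combination 2 * hss - s * s * hI
    · linear_combination s * s * hI
    · linear_combination s * s * hI
    · linear_combination 2 * hss - s * s * hI
  refine ⟨P * V, ?_, r, ⟨x, -y⟩, by simpa using hy, ?_⟩
  · rw [Matrix.mem_unitaryGroup_iff', star_mul]
    calc star V * star P * (P * V) = star V * (star P * P) * V := by
          simp only [Matrix.mul_assoc]
      _ = 1 := by rw [hPP, mul_one, hVV]
  · have ha : (⟨x, -y⟩ : ℂ) = x - y * Complex.I := by apply Complex.ext <;> simp
    have ha' : starRingEnd ℂ (⟨x, -y⟩ : ℂ) = x + y * Complex.I := by apply Complex.ext <;> simp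
    rw [ha', ha]
    calc star (P * V) * toComplexMatrix A * (P * V)
        = star V * (star P * toComplexMatrix A * P) * V := by
          rw [star_mul]; simp only [Matrix.mul_assoc]
      _ = _ := by
        rw [hPB, hVs, hV]
        ext i j
        fin_cases i <;> fin_cases j <;>
          simp [Matrix.mul_apply, Fin.sum_univ_three, toComplexMatrix, Matrix.vecMul, dotProduct]
        · linear_combination 2 * (x - y * Complex.I) * hss - s * s * x * hI
        · linear_combination s * s * x * hI
        · linear_combination s * s * x * hI
        · linear_combination 2 * (x + y * Complex.I) * hss - s * s * x * hI

theorem corollary3p4 :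
    (∀ K : Set ℂ, IsTriangleSet K → (starRingEnd ℂ) '' K = K →
      (∃ (r : ℝ) (a : ℂ), K = triangleHull (r : ℂ) a (starRingEnd ℂ a)) ∧
      (∀ (r : ℝ) (a : ℂ), K = triangleHull (r : ℂ) a (starRingEnd ℂ a) →
        IsStarCenter ((‖a‖ ^ 2 : ℝ) : ℂ) (K * K))) ∧
    (∀ A : Matrix (Fin 3) (Fin 3) ℝ, IsStarNormal A →
      IsStarShaped (numRange (toComplexMatrix A) * numRange (toComplexMatrix A)) ∧
      (A.IsHermitian →
        Convex ℝ (numRange (toComplexMatrix A) * numRange (toComplexMatrix A))) ∧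
      (¬ A.IsHermitian →
        ∃ (r : ℝ) (a : ℂ), a.im ≠ 0 ∧
          spectrum ℂ (toComplexMatrix A) = {(r : ℂ), a, starRingEnd ℂ a} ∧
          IsStarCenter ((‖a‖ ^ 2 : ℝ) : ℂ)
            (numRange (toComplexMatrix A) * numRange (toComplexMatrix A)))) := by
  refine ⟨fun K hK hconj => ⟨exists_eq_triangleHull_conj hK hconj, ?_⟩, fun A hA => ?_⟩
  · rintro r a rfl
    exact isStarCenter_mul_self_triangleHull r a
  have hherm : A.IsHermitian →
      Convex ℝ (numRange (toComplexMatrix A) * numRange (toComplexMatrix A)) := by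
    intro h
    apply convex_numRange_mul_self_of_isHermitian
    ext i j
    simpa [toComplexMatrix] using congrFun (congrFun h i) j
  have hnon : ¬ A.IsHermitian → ∃ (r : ℝ) (a : ℂ), a.im ≠ 0 ∧
      spectrum ℂ (toComplexMatrix A) = {(r : ℂ), a, starRingEnd ℂ a} ∧
      IsStarCenter ((‖a‖ ^ 2 : ℝ) : ℂ)
        (numRange (toComplexMatrix A) * numRange (toComplexMatrix A)) := by
    intro h
    obtain ⟨U, hU, r, a, ha, hd⟩ := exists_unitary_diagonal hA h
    refine ⟨r, a, ha, ?_, ?_⟩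
    · rw [spectrum_eq_of_unitary_diagonal hU hd]
      ext z
      simp [Matrix.range_cons]
      tauto
    · rw [numRange_eq_triangleHull hU hd]
      exact isStarCenter_mul_self_triangleHull r a
  refine ⟨?_, hherm, hnon⟩
  by_cases h : A.IsHermitian
  -- Every point of a convex set is a star center; the first diagonal entry, attained at the first
  -- basis vector, supplies one.
  · have hx : toComplexMatrix A 0 0 ∈ numRange (toComplexMatrix A) :=
      ⟨Pi.single 0 1, by simp, by simp⟩
    exact ⟨_, Set.mul_mem_mul hx hx, (hherm h).starConvex (Set.mul_mem_mul hx hx)⟩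
  · obtain ⟨r, a, -, -, hstar⟩ := hnon h
    exact ⟨_, hstar⟩
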